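/- Corollary 2.5 (average number of down-steps). Let $k, t, n$ be non-negative integers with $0 \le t < k$. A $k_t$-Dyck path of length $(k+1)n$ is a lattice path consisting of $n$ down-steps $(1,-k)$ and $kn$ up-steps $(1,1)$ that starts at $(0,0)$, ends at $((k+1)n,0)$, and stays weakly above the line $y=-t$. A down-step is at a height of $i$ modulo $k$ if the height ($y$-coordinate) of its endpoint is congruent to $i$ modulo $k$. Then the (non-empty, finite) set of all $k_t$-Dyck paths of length $(k+1)n$ has the following property: the average, over all paths in this set, of the number of down-steps at a height of $i$ modulo $k$ is 1. $\displaystyle \frac{n\,((t+1)n+k+1)}{(kn+t+2)(t+1)}$ if $k-t \le i \le k$; 2. $\displaystyle \frac{n(n-1)}{kn+t+2}$ if $1 \le i \le k-t-1$. -/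

import Mathlib

namespace KtDyck

/-- The two kinds of steps of a lattice path: `up` is the step `(1, 1)` and `down` is the
step `(1, -k)`. -/
inductive Step where
  | up
  | down
  deriving DecidableEq

instance : Fintype Step where
  elems := {Step.up, Step.down}
  complete := by intro s; cases s <;> simp

/-- The change of height made by a step: `up` is `(1, 1)`, `down` is `(1, -k)`. -/
def Step.rise (k : ℕ) : Step → ℤ
  | Step.up => 1
  | Step.down => -(k : ℤ)

/-- The height (`y`-coordinate) at `x`-coordinate `j` of the lattice path that starts at `(0, 0)`
and makes the steps `p 0, p 1, …, p (N - 1)` in this order. -/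
def height (k : ℕ) {N : ℕ} (p : Fin N → Step) (j : ℕ) : ℤ :=
  ∑ m : Fin N with m.val < j, (p m).rise k

/-- `p` is a `k_t`-Dyck path of length `(k + 1) * n`: it has `n` steps `(1, -k)` and `k * n` steps
`(1, 1)`, starts at `(0, 0)`, ends at `((k + 1) * n, 0)`, and stays weakly above the line
`y = -t`. -/
def IsPath (k t n : ℕ) (p : Fin ((k + 1) * n) → Step) : Prop :=
  (Finset.univ.filter fun m => p m = Step.down).card = n ∧
  (Finset.univ.filter fun m => p m = Step.up).card = k * n ∧
  height k p ((k + 1) * n) = 0 ∧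
  ∀ j ≤ (k + 1) * n, -(t : ℤ) ≤ height k p j

instance (k t n : ℕ) : DecidablePred (IsPath k t n) := fun p => by
  unfold IsPath
  infer_instance

/-- The finite set of all `k_t`-Dyck paths of length `(k + 1) * n`. -/
def paths (k t n : ℕ) : Finset (Fin ((k + 1) * n) → Step) :=
  Finset.univ.filter (IsPath k t n)

/-- The number of down-steps `(1, -k)` of `p` at a height of `i` modulo `k`, that is, of the
down-steps whose endpoint has height congruent to `i` modulo `k`. -/
def downStepsAt (k : ℕ) {N : ℕ} (p : Fin N → Step) (i : ℕ) : ℕ :=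
  (Finset.univ.filter fun m : Fin N =>
    p m = Step.down ∧ height k p (m.val + 1) ≡ (i : ℤ) [ZMOD (k : ℤ)]).card

/-- The average number of down-steps at a height of `i` modulo `k`, taken over all `k_t`-Dyck paths
of length `(k + 1) * n`. -/
def averageDownSteps (k t n i : ℕ) : ℚ :=
  (∑ p ∈ paths k t n, (downStepsAt k p i : ℚ)) / ((paths k t n).card : ℚ)

end KtDyck

namespace KtDyck

open Finset

/-! A down-step preceded by u up-steps and d down-steps ends at height u - k(d+1) ≡ u mod k, so it
suffices to count pairs (path, marked down-step after exactly v up-steps), v ≡ i mod k. Swapping the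
marked step with the next up-step turns v into v + 1; this is reversible unless k ∣ v + 1 + t, so
the count is constant on blocks of k consecutive v (`markedCount_succ_height`). Hence every residue
receives the same sum E, one term per block, and the t + 1 residues with k - t ≤ i ≤ k also receive
the truncated last block D, the count at v = kn. Since each path has n down-steps, kE + (t+1)D =
n·#paths (`sum_markedCount_total`). D is a prefix count (`markedCount_last`), and prefix counts have
a ballot-type closed form (`prefixCount_eq`), which determines E. -/

/-- The sum of `f` over the first `j` steps of `p`. -/
def prefixSum (f : Step → ℤ) {N : ℕ} (p : Fin N → Step) (j : ℕ) : ℤ :=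
  ∑ m : Fin N with m.val < j, f (p m)

/-- Indicator of an up-step. -/
def Step.upInd : Step → ℤ
  | Step.up => 1
  | Step.down => 0

/-- Indicator of a down-step. -/
def Step.downInd : Step → ℤ
  | Step.up => 0
  | Step.down => 1

theorem sum_step {A : Type*} [AddCommMonoid A] (f : Step → A) :
    ∑ x : Step, f x = f Step.up + f Step.down := by
  have : (univ : Finset Step) = {Step.up, Step.down} := rfl
  rw [this, sum_pair (by decide)]

theorem prefixSum_eq_sum (f : Step → ℤ) {N : ℕ} (p : Fin N → Step) :
    prefixSum f p N = ∑ m, f (p m) := by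
  unfold prefixSum
  congr 1
  ext m
  simp

theorem prefixSum_snoc_of_le (f : Step → ℤ) {N : ℕ} (p : Fin N → Step) (x : Step) {j : ℕ}
    (hj : j ≤ N) :
    prefixSum f (Fin.snoc p x : Fin (N + 1) → Step) j = prefixSum f p j := by
  unfold prefixSum
  rw [sum_filter, sum_filter, Fin.sum_univ_castSucc]
  simp [hj]

theorem prefixSum_snoc_last (f : Step → ℤ) {N : ℕ} (p : Fin N → Step) (x : Step) :
    prefixSum f (Fin.snoc p x : Fin (N + 1) → Step) (N + 1) = prefixSum f p N + f x := by
  rw [prefixSum_eq_sum, prefixSum_eq_sum, Fin.sum_univ_castSucc]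
  simp

theorem prefixSum_succ (f : Step → ℤ) {N : ℕ} (p : Fin N → Step) (m : Fin N) :
    prefixSum f p (m.val + 1) = prefixSum f p m.val + f (p m) := by
  unfold prefixSum
  have : (univ.filter fun a : Fin N => a.val < m.val + 1) =
      insert m (univ.filter fun a : Fin N => a.val < m.val) := by
    ext a
    simp only [mem_filter, mem_univ, true_and, mem_insert, Fin.ext_iff]
    omega
  rw [this, sum_insert (by simp), add_comm]

theorem height_eq (k : ℕ) {N : ℕ} (p : Fin N → Step) (j : ℕ) :
    height k p j = prefixSum Step.upInd p j - k * prefixSum Step.downInd p j := by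
  unfold height prefixSum
  rw [mul_sum, ← sum_sub_distrib]
  refine sum_congr rfl fun m _ => ?_
  cases p m <;> simp [Step.rise, Step.upInd, Step.downInd]

theorem prefixSum_up_add_down {N : ℕ} (p : Fin N → Step) :
    prefixSum Step.upInd p N + prefixSum Step.downInd p N = N := by
  rw [prefixSum_eq_sum, prefixSum_eq_sum, ← sum_add_distrib]
  have : ∀ m, (p m).upInd + (p m).downInd = 1 := by
    intro m
    cases p m <;> rfl
  simp [this]

theorem prefixSum_upInd_nonneg {N : ℕ} (p : Fin N → Step) (j : ℕ) :
    0 ≤ prefixSum Step.upInd p j :=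
  sum_nonneg fun m _ => by cases p m <;> simp [Step.upInd]

theorem prefixSum_upInd_le {N : ℕ} (p : Fin N → Step) (j : ℕ) :
    prefixSum Step.upInd p j ≤ prefixSum Step.upInd p N := by
  rw [prefixSum_eq_sum]
  refine sum_le_sum_of_subset_of_nonneg (filter_subset _ _) fun m _ _ => ?_
  cases p m <;> simp [Step.upInd]

theorem card_down_eq {N : ℕ} (p : Fin N → Step) :
    ((univ.filter fun m => p m = Step.down).card : ℤ) = prefixSum Step.downInd p N := by
  rw [prefixSum_eq_sum, card_filter]
  push_cast
  refine sum_congr rfl fun m _ => ?_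
  cases p m <;> simp [Step.downInd]

theorem card_up_eq {N : ℕ} (p : Fin N → Step) :
    ((univ.filter fun m => p m = Step.up).card : ℤ) = prefixSum Step.upInd p N := by
  rw [prefixSum_eq_sum, card_filter]
  push_cast
  refine sum_congr rfl fun m _ => ?_
  cases p m <;> simp [Step.upInd]

/-! ### Path prefixes and last-step recurrences -/

/-- The lattice paths with `N` steps, `s` of them down-steps, that stay weakly above `y = -t`. -/
def prefixes (k t N : ℕ) (s : ℤ) : Finset (Fin N → Step) :=
  univ.filter fun p => prefixSum Step.downInd p N = s ∧ ∀ j ≤ N, -(t : ℤ) ≤ height k p j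

theorem mem_prefixes {k t N : ℕ} {s : ℤ} {p : Fin N → Step} :
    p ∈ prefixes k t N s ↔
      prefixSum Step.downInd p N = s ∧ ∀ j ≤ N, -(t : ℤ) ≤ height k p j := by
  simp [prefixes]

theorem paths_eq_prefixes (k t n : ℕ) : paths k t n = prefixes k t ((k + 1) * n) n := by
  ext p
  simp only [paths, mem_filter, mem_univ, true_and, mem_prefixes, IsPath]
  have h1 := card_down_eq p
  have h2 := card_up_eq p
  have h3 := prefixSum_up_add_down p
  have h4 := height_eq k p ((k + 1) * n)
  constructor
  · rintro ⟨a, -, -, d⟩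
    exact ⟨by rw [← h1, a], d⟩
  · rintro ⟨a, d⟩
    rw [a] at h1 h3 h4
    push_cast at h3
    have h5 : prefixSum Step.upInd p ((k + 1) * n) = k * n := by linarith
    refine ⟨by exact_mod_cast h1, ?_, by rw [h4, h5]; ring, d⟩
    rw [h5] at h2
    exact_mod_cast h2

theorem snoc_mem_prefixes {k t N : ℕ} {s : ℤ} {p : Fin N → Step} {x : Step} :
    (Fin.snoc p x : Fin (N + 1) → Step) ∈ prefixes k t (N + 1) s ↔
      (k * s ≤ N + 1 - s + t) ∧ p ∈ prefixes k t N (s - x.downInd) := by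
  rw [mem_prefixes, mem_prefixes, prefixSum_snoc_last]
  have hlast : height k (Fin.snoc p x : Fin (N + 1) → Step) (N + 1) =
      (N + 1 : ℤ) - prefixSum Step.downInd (Fin.snoc p x : Fin (N + 1) → Step) (N + 1)
        - k * prefixSum Step.downInd (Fin.snoc p x : Fin (N + 1) → Step) (N + 1) := by
    have := prefixSum_up_add_down (Fin.snoc p x : Fin (N + 1) → Step)
    rw [height_eq]
    push_cast at this
    linarith
  rw [prefixSum_snoc_last] at hlast
  have hle : ∀ j ≤ N, height k (Fin.snoc p x : Fin (N + 1) → Step) j = height k p j :=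
    fun j hj => prefixSum_snoc_of_le (Step.rise k) p x hj
  constructor
  · rintro ⟨a, b⟩
    have := b (N + 1) le_rfl
    rw [hlast, a] at this
    refine ⟨by linarith, by linarith, fun j hj => ?_⟩
    rw [← hle j hj]
    exact b j (by omega)
  · rintro ⟨c, a, b⟩
    have a' : prefixSum Step.downInd p N + x.downInd = s := by linarith
    refine ⟨a', fun j hj => ?_⟩
    rcases Nat.lt_or_ge N j with h | h
    · obtain rfl : j = N + 1 := by omega
      rw [hlast, a']
      linarith
    · rw [hle j h]
      exact b j h

theorem sum_prefixes_succ (k t N : ℕ) (s : ℤ) (F : (Fin (N + 1) → Step) → ℚ) :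
    ∑ p ∈ prefixes k t (N + 1) s, F p =
      if k * s ≤ N + 1 - s + t then
        ∑ p ∈ prefixes k t N s, F (Fin.snoc p Step.up) +
          ∑ p ∈ prefixes k t N (s - 1), F (Fin.snoc p Step.down)
      else 0 := by
  have h1 : ∑ p ∈ prefixes k t (N + 1) s, F p =
      ∑ p, if p ∈ prefixes k t (N + 1) s then F p else 0 := by simp
  rw [h1, ← (Fin.snocEquiv fun _ => Step).sum_comp, Fintype.sum_prod_type, sum_step]
  simp only [Fin.snocEquiv, Equiv.coe_fn_mk, snoc_mem_prefixes]
  split_ifs with h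
  · simp [h, Step.downInd]
  · simp [h]

/-- The number of down-steps of `p` that come after exactly `v` up-steps. -/
def downsAfter (v : ℤ) {N : ℕ} (p : Fin N → Step) : ℚ :=
  ∑ m : Fin N, if p m = Step.down ∧ prefixSum Step.upInd p m.val = v then 1 else 0

theorem downsAfter_snoc (v : ℤ) {N : ℕ} (p : Fin N → Step) (x : Step) :
    downsAfter v (Fin.snoc p x : Fin (N + 1) → Step) =
      downsAfter v p + if x = Step.down ∧ prefixSum Step.upInd p N = v then 1 else 0 := by
  unfold downsAfter
  rw [Fin.sum_univ_castSucc]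
  simp [prefixSum_snoc_of_le, Fin.is_le']

/-- The number of elements of `prefixes k t N s`. -/
def prefixCount (k t N : ℕ) (s : ℤ) : ℚ := ((prefixes k t N s).card : ℚ)

/-- The number of elements of `prefixes k t N s` with a marked down-step that comes after
exactly `v` up-steps. -/
def markedCount (k t : ℕ) (v : ℤ) (N : ℕ) (s : ℤ) : ℚ :=
  ∑ p ∈ prefixes k t N s, downsAfter v p

theorem prefixCount_zero (k t : ℕ) (s : ℤ) : prefixCount k t 0 s = if s = 0 then 1 else 0 := by
  unfold prefixCount
  split_ifs with h
  · have : prefixes k t 0 s = univ := by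
      ext p
      simp only [mem_prefixes, h, mem_univ, iff_true]
      simp [prefixSum, height]
    simp [this]
  · have : prefixes k t 0 s = ∅ := by
      ext p
      simp [mem_prefixes, prefixSum, Ne.symm h]
    simp [this]

theorem prefixCount_succ (k t N : ℕ) (s : ℤ) :
    prefixCount k t (N + 1) s =
      if k * s ≤ N + 1 - s + t then prefixCount k t N s + prefixCount k t N (s - 1) else 0 := by
  have h := sum_prefixes_succ k t N s fun _ => 1
  simpa [prefixCount] using h

theorem markedCount_zero (k t : ℕ) (v s : ℤ) : markedCount k t v 0 s = 0 := by
  simp [markedCount, downsAfter]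

theorem markedCount_succ (k t : ℕ) (v : ℤ) (N : ℕ) (s : ℤ) :
    markedCount k t v (N + 1) s =
      if k * s ≤ N + 1 - s + t then
        markedCount k t v N s + markedCount k t v N (s - 1) +
          (if N + 1 - s = v then prefixCount k t N (s - 1) else 0)
      else 0 := by
  unfold markedCount
  rw [sum_prefixes_succ]
  congr 1
  simp only [downsAfter_snoc, reduceCtorEq, false_and, if_false, add_zero, true_and]
  rw [sum_add_distrib, add_assoc]
  congr 2
  have : ∀ p ∈ prefixes k t N (s - 1), (prefixSum Step.upInd p N = v ↔ N + 1 - s = v) := by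
    intro p hp
    have h1 := prefixSum_up_add_down p
    rw [(mem_prefixes.1 hp).1] at h1
    constructor <;> intro h <;> linarith
  rw [sum_congr rfl fun p hp => if_congr (this p hp) rfl rfl]
  split_ifs <;> simp [prefixCount]

/-! ### How marked counts depend on the number of preceding up-steps -/

theorem markedCount_eq_zero_of_lt (k t : ℕ) (v : ℤ) (N : ℕ) (s : ℤ) (h : N - s < v) :
    markedCount k t v N s = 0 := by
  induction N generalizing s with
  | zero => exact markedCount_zero ..
  | succ N ih =>
    push_cast at h
    rw [markedCount_succ, ih s (by linarith), ih (s - 1) (by linarith), if_neg h.ne]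
    simp

theorem markedCount_eq_zero_of_neg (k t : ℕ) (v : ℤ) (N : ℕ) (s : ℤ) (h : v < 0) :
    markedCount k t v N s = 0 := by
  refine sum_eq_zero fun p _ => sum_eq_zero fun m _ => if_neg ?_
  rintro ⟨-, h'⟩
  have := prefixSum_upInd_nonneg p m.val
  omega

/-- When v is the total number of up-steps, turn the marked down-step into an up-step. Conversely,
turn the last up-step into a marked down-step: only down-steps follow, so the path stays admissible
as soon as its endpoint is, which is `hs`. -/
theorem markedCount_last {k t : ℕ} (htk : t < k) {v : ℤ} (N : ℕ) (s : ℤ) (h : N - s = v)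
    (hs : k * s ≤ v + t) :
    markedCount k t v N s = prefixCount k t N (s - 1) := by
  induction N generalizing s with
  | zero =>
    rw [markedCount_zero, prefixCount_zero, if_neg]
    intro h1
    have h2 : s = 1 := by linarith
    subst h2
    push_cast at h
    have : (t : ℤ) < k := by exact_mod_cast htk
    linarith
  | succ N ih =>
    push_cast at h
    have hk : (0 : ℤ) ≤ k := by positivity
    rw [markedCount_succ, if_pos (by linarith), if_pos h,
      markedCount_eq_zero_of_lt k t v N s (by linarith),
      ih (s - 1) (by linarith) (by linarith), prefixCount_succ, if_pos (by linarith)]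
    ring

/-- Swap the marked down-step with the next up-step. Undoing this can violate the boundary only if
the marked step ends exactly at height -t, which forces k ∣ v + 1 + t. The induction on the last
step encodes this bijection. -/
theorem markedCount_succ_height {k t : ℕ} (htk : t < k) {v : ℤ} (hv : ¬ (k : ℤ) ∣ v + 1 + t)
    (N : ℕ) (s : ℤ) (h : v + 1 ≤ N - s) :
    markedCount k t v N s = markedCount k t (v + 1) N s := by
  induction N generalizing s with
  | zero => rw [markedCount_zero, markedCount_zero]
  | succ N ih =>
    push_cast at h
    rw [markedCount_succ, markedCount_succ, ih (s - 1) (by linarith)]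
    split_ifs with h1 h2 h3 h3
    · linarith
    · linarith
    -- Non-divisibility excludes an endpoint at height exactly -t, leaving the room that
    -- `markedCount_last` needs one up-step earlier.
    · have h4 : k * s ≤ v + t := by
        have : k * s ≠ v + 1 + t := fun h5 => hv ⟨s, h5.symm⟩
        omega
      rw [markedCount_last htk N s (by linarith) h4,
        markedCount_eq_zero_of_lt k t (v + 1) N s (by linarith)]
      ring
    · rw [ih s (by omega)]
    · rfl

theorem markedCount_eq_of_block {k t : ℕ} (htk : t < k) {N : ℕ} {s : ℤ} {m a b : ℤ}
    (hab : a ≤ b) (ha : k * m ≤ a + t) (hb : b + t < k * m + k) (hbN : b ≤ N - s) :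
    markedCount k t a N s = markedCount k t b N s := by
  induction b, hab using Int.leInduction with
  | base => rfl
  | succ b hab ih =>
    rw [ih (by linarith) (by linarith), markedCount_succ_height htk _ N s hbN]
    rintro ⟨c, hc⟩
    have hk : (0 : ℤ) < k := by omega
    have h1 : m < c := by
      by_contra! h
      have := mul_le_mul_of_nonneg_left h hk.le
      linarith
    have h2 : c < m + 1 := by
      by_contra! h
      have := mul_le_mul_of_nonneg_left h hk.le
      linarith
    omega

/-! ### Closed form for prefix counts -/

/-- The binomial coefficient with an integer lower index, zero if that index is negative. -/
def chooseInt (n : ℕ) (s : ℤ) : ℚ := if 0 ≤ s then (n.choose s.toNat : ℚ) else 0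

theorem chooseInt_natCast (n s : ℕ) : chooseInt n s = n.choose s := by simp [chooseInt]

theorem chooseInt_of_neg (n : ℕ) {s : ℤ} (h : s < 0) : chooseInt n s = 0 := by
  simp [chooseInt, h]

theorem chooseInt_succ (n : ℕ) (s : ℤ) :
    chooseInt (n + 1) s = chooseInt n s + chooseInt n (s - 1) := by
  rcases lt_or_ge s 0 with h | h
  · rw [chooseInt_of_neg _ h, chooseInt_of_neg _ h, chooseInt_of_neg _ (by omega), add_zero]
  · lift s to ℕ using h
    cases s with
    | zero => simp [chooseInt]
    | succ s =>
      have : ((s + 1 : ℕ) : ℤ) - 1 = (s : ℕ) := by push_cast; ring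
      rw [this, chooseInt_natCast, chooseInt_natCast, chooseInt_natCast, Nat.choose_succ_succ]
      push_cast
      ring

theorem mul_chooseInt (n : ℕ) (s : ℤ) :
    s * chooseInt n s = (n - s + 1) * chooseInt n (s - 1) := by
  rcases lt_or_ge s 0 with h | h
  · rw [chooseInt_of_neg _ h, chooseInt_of_neg _ (by omega), mul_zero, mul_zero]
  · lift s to ℕ using h
    cases s with
    | zero => simp [chooseInt]
    | succ s =>
      have : ((s + 1 : ℕ) : ℤ) - 1 = (s : ℕ) := by push_cast; ring
      rw [this, chooseInt_natCast, chooseInt_natCast]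
      push_cast
      rcases le_or_gt s n with h | h
      · have h1 := Nat.choose_succ_right_eq n s
        have h2 : (n.choose (s + 1) : ℚ) * (s + 1) = n.choose s * (n - s) := by
          rw [← Nat.cast_sub h]
          exact_mod_cast h1
        linarith
      · rw [Nat.choose_eq_zero_of_lt h, Nat.choose_eq_zero_of_lt (by omega)]
        simp

/-- Both sides satisfy Pascal's recurrence. The range includes endpoints at height -t - 1, one below
the boundary, where both sides vanish; this keeps the induction closed. -/
theorem prefixCount_eq {k t : ℕ} (htk : t < k) (N : ℕ) (s : ℤ) (hs : k * s ≤ N - s + t + 1) :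
    prefixCount k t N s = chooseInt (N + t) s - k * chooseInt (N + t) (s - 1) := by
  have hk : (t : ℤ) < k := by exact_mod_cast htk
  induction N generalizing s with
  | zero =>
    have h0 : s ≤ 0 := by
      by_contra! h
      push_cast at hs
      nlinarith
    rw [prefixCount_zero, chooseInt_of_neg _ (show s - 1 < 0 by omega)]
    split_ifs with h
    · simp [h, chooseInt]
    · rw [chooseInt_of_neg _ (by omega)]
      simp
  | succ N ih =>
    push_cast at hs
    rw [prefixCount_succ]
    split_ifs with h
    · rw [ih s (by linarith), ih (s - 1) (by linarith), show N + 1 + t = N + t + 1 by ring,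
        chooseInt_succ, chooseInt_succ _ (s - 1)]
      ring
    -- The endpoint is at height -t - 1: here (N+1+t) - s + 1 = ks, so `mul_chooseInt` makes the
    -- right side vanish.
    · have h1 : k * s = N + 1 - s + t + 1 := by omega
      have h2 := mul_chooseInt (N + 1 + t) s
      have h3 : (k : ℚ) * s = N + 1 - s + t + 1 := by exact_mod_cast h1
      have h4 : (s : ℚ) ≠ 0 := by
        rintro h5
        have h6 : s = 0 := by exact_mod_cast h5
        rw [h6] at h1
        have : (0 : ℤ) ≤ N := by positivity
        linarith
      push_cast at h2
      apply mul_left_cancel₀ h4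
      linear_combination -h2 + chooseInt (N + 1 + t) (s - 1) * h3

/-! ### Down-steps by residue class -/

theorem downStepsAt_eq_sum (k : ℕ) {n : ℕ} {N : ℕ} (p : Fin N → Step) {i : ℕ} (hi : 1 ≤ i)
    (hik : i ≤ k) (hp : prefixSum Step.upInd p N = k * n) :
    (downStepsAt k p i : ℚ) = ∑ m ∈ range (n + 1), downsAfter (k * m + i - k) p := by
  unfold downsAfter downStepsAt
  rw [sum_comm, card_filter]
  push_cast
  refine sum_congr rfl fun a _ => ?_
  by_cases ha : p a = Step.down
  swap
  · simp [ha]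
  have h1 : height k p (a.val + 1) =
      prefixSum Step.upInd p a.val - k * (prefixSum Step.downInd p a.val + 1) := by
    rw [height_eq, prefixSum_succ, prefixSum_succ, ha]
    simp [Step.upInd, Step.downInd]
  have h0 := prefixSum_upInd_nonneg p a.val
  have h2 := prefixSum_upInd_le p a.val
  rw [hp] at h2
  have hkpos : (0 : ℤ) < k := by omega
  rw [h1]
  set u := prefixSum Step.upInd p a.val
  set d := prefixSum Step.downInd p a.val
  simp only [ha, true_and]
  split_ifs with h
  · obtain ⟨c, hc⟩ := h.symm.dvd
    have hu : u = k * (c + d + 2) + i - k := by linear_combination hc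
    have hc0 : 0 ≤ c + d + 2 := by
      by_contra! hneg
      have : k * (c + d + 2) ≤ k * (-1) := mul_le_mul_of_nonneg_left (by omega) hkpos.le
      omega
    obtain ⟨e, he⟩ := Int.eq_ofNat_of_zero_le hc0
    rw [he] at hu
    have hen : e ≤ n := by
      by_contra! hgt
      have : (k : ℤ) * (n + 1) ≤ k * e := mul_le_mul_of_nonneg_left (by omega) hkpos.le
      linarith
    rw [sum_eq_single e, if_pos hu]
    · intro b _ hbe
      rw [if_neg]
      intro hb
      have : (k : ℤ) * b = k * e := by linarith
      exact hbe (by exact_mod_cast mul_left_cancel₀ hkpos.ne' this)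
    · intro hne
      exact absurd (mem_range.2 (by omega)) hne
  · symm
    refine sum_eq_zero fun m _ => if_neg fun hm => h ?_
    refine (Int.modEq_of_dvd ⟨m - 1 - (d + 1), ?_⟩).symm
    rw [hm]
    ring

theorem sum_downStepsAt {k : ℕ} (hk : 0 < k) {N : ℕ} (p : Fin N → Step) :
    ∑ i ∈ Icc 1 k, downStepsAt k p i = (univ.filter fun m => p m = Step.down).card := by
  unfold downStepsAt
  simp only [card_filter]
  rw [sum_comm]
  refine sum_congr rfl fun a _ => ?_
  by_cases ha : p a = Step.down
  swap
  · simp [ha]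
  simp only [ha, true_and, if_true]
  set h := height k p (a.val + 1)
  have hk' : (0 : ℤ) < k := by exact_mod_cast hk
  have h0 := Int.emod_nonneg (h - 1) hk'.ne'
  have h1 := Int.emod_lt_of_pos (h - 1) hk'
  have h2 := Int.emod_add_mul_ediv (h - 1) k
  obtain ⟨e, he⟩ := Int.eq_ofNat_of_zero_le h0
  have he' : h ≡ ((e + 1 : ℕ) : ℤ) [ZMOD k] := by
    refine (Int.modEq_of_dvd ⟨(h - 1) / k, ?_⟩).symm
    push_cast
    linarith
  rw [sum_eq_single (e + 1), if_pos he']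
  · intro b hb hbe
    rw [if_neg]
    intro hb'
    rw [mem_Icc] at hb
    have h3 := (Int.natCast_modEq_iff.1 (hb'.symm.trans he'))
    have h4 : b - 1 ≡ e [MOD k] := by
      apply Nat.ModEq.add_right_cancel' 1
      rwa [Nat.sub_add_cancel hb.1]
    have := h4.eq_of_lt_of_lt (by omega) (by omega)
    omega
  · intro hne
    exact absurd (mem_Icc.2 (by omega)) hne

theorem up_prefixSum_of_mem_paths {k t n : ℕ} {p : Fin ((k + 1) * n) → Step}
    (hp : p ∈ paths k t n) : prefixSum Step.upInd p ((k + 1) * n) = k * n := by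
  have h := (mem_filter.1 hp).2.2.1
  rw [← card_up_eq, h]
  push_cast
  rfl

theorem sum_paths_downStepsAt (k t n : ℕ) {i : ℕ} (hi : 1 ≤ i) (hik : i ≤ k) :
    ∑ p ∈ paths k t n, (downStepsAt k p i : ℚ) =
      ∑ m ∈ range (n + 1), markedCount k t (k * m + i - k) ((k + 1) * n) n := by
  rw [sum_congr rfl fun p hp => downStepsAt_eq_sum k p hi hik (up_prefixSum_of_mem_paths hp),
    sum_comm]
  simp only [markedCount, paths_eq_prefixes]

theorem sum_paths_downStepsAt_high {k t : ℕ} (htk : t < k) (n : ℕ) {i : ℕ} (hi : k - t ≤ i)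
    (hik : i ≤ k) :
    ∑ p ∈ paths k t n, (downStepsAt k p i : ℚ) =
      ∑ m ∈ range n, markedCount k t (k * m) ((k + 1) * n) n +
        markedCount k t (k * n) ((k + 1) * n) n := by
  rw [sum_paths_downStepsAt k t n (by omega) hik, ← sum_range_succ
    (fun m : ℕ => markedCount k t (k * m) ((k + 1) * n) n)]
  refine sum_congr rfl fun m hm => ?_
  have hmn : (k : ℤ) * m ≤ k * n :=
    mul_le_mul_of_nonneg_left (by have := mem_range.1 hm; omega) (by positivity)
  refine markedCount_eq_of_block htk (m := m) ?_ ?_ ?_ ?_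
  · omega
  · omega
  · omega
  · push_cast
    linarith

theorem sum_paths_downStepsAt_low {k t : ℕ} (htk : t < k) (n : ℕ) {i : ℕ} (hi : 1 ≤ i)
    (hik : i ≤ k - t - 1) :
    ∑ p ∈ paths k t n, (downStepsAt k p i : ℚ) =
      ∑ m ∈ range n, markedCount k t (k * m) ((k + 1) * n) n := by
  -- The term m = 0 has v = i - k < 0 and drops out; the shift then puts v = km + i in the block of
  -- km.
  rw [sum_paths_downStepsAt k t n hi (by omega), sum_range_succ',
    markedCount_eq_zero_of_neg _ _ _ _ _ (by push_cast; omega), add_zero]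
  refine sum_congr rfl fun m hm => ?_
  have hmn : (k : ℤ) * (m + 1) ≤ k * n :=
    mul_le_mul_of_nonneg_left (by have := mem_range.1 hm; omega) (by positivity)
  rw [mul_add] at hmn
  symm
  have hv : (k : ℤ) * ((m + 1 : ℕ) : ℤ) + i - k = k * m + i := by push_cast; ring
  rw [hv]
  refine markedCount_eq_of_block htk (m := m) ?_ ?_ ?_ ?_
  · omega
  · omega
  · omega
  · push_cast
    have : (i : ℤ) ≤ k := by omega
    linarith

/-- Double counting of all down-steps: every residue contributes E, and t + 1 of the k residues
contribute D as well. -/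
theorem sum_markedCount_total {k t : ℕ} (htk : t < k) (n : ℕ) :
    (k : ℚ) * ∑ m ∈ range n, markedCount k t (k * m) ((k + 1) * n) n +
      (t + 1) * markedCount k t (k * n) ((k + 1) * n) n = n * (paths k t n).card := by
  have h1 : ∑ i ∈ Icc 1 k, ∑ p ∈ paths k t n, (downStepsAt k p i : ℚ) =
      n * (paths k t n).card := by
    rw [sum_comm]
    have : ∀ p ∈ paths k t n, ∑ i ∈ Icc 1 k, (downStepsAt k p i : ℚ) = n := by
      intro p hp
      have h := sum_downStepsAt (by omega : 0 < k) p
      rw [(mem_filter.1 hp).2.1] at h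
      exact_mod_cast h
    rw [sum_congr rfl this, sum_const, nsmul_eq_mul, mul_comm]
  rw [← h1]
  set E := ∑ m ∈ range n, markedCount k t (k * m) ((k + 1) * n) n
  set D := markedCount k t (k * n) ((k + 1) * n) n
  have h2 : ∀ i ∈ Icc 1 k, ∑ p ∈ paths k t n, (downStepsAt k p i : ℚ) =
      E + if k - t ≤ i then D else 0 := by
    intro i hi
    rw [mem_Icc] at hi
    split_ifs with h
    · exact sum_paths_downStepsAt_high htk n h hi.2
    · rw [add_zero]
      exact sum_paths_downStepsAt_low htk n hi.1 (by omega)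
  rw [sum_congr rfl h2, sum_add_distrib, ← sum_filter]
  have h3 : (Icc 1 k).filter (fun i => k - t ≤ i) = Icc (k - t) k := by
    ext i
    simp only [mem_filter, mem_Icc]
    omega
  rw [h3, sum_const, sum_const, Nat.card_Icc, Nat.card_Icc, nsmul_eq_mul, nsmul_eq_mul,
    show k + 1 - (k - t) = t + 1 by omega]
  push_cast
  simp

/-! ### Evaluation of the counts -/

theorem card_paths_mul {k t : ℕ} (htk : t < k) (n : ℕ) :
    ((k : ℚ) * n + t + 1) * (paths k t n).card =
      (t + 1) * (((k + 1) * n + t).choose n : ℚ) := by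
  have h1 := prefixCount_eq htk ((k + 1) * n) n (by push_cast; linarith)
  have h2 := mul_chooseInt ((k + 1) * n + t) n
  rw [prefixCount, ← paths_eq_prefixes] at h1
  rw [h1]
  rw [chooseInt_natCast] at *
  push_cast at h2
  linear_combination (k : ℚ) * h2

theorem markedCount_last_mul {k t : ℕ} (htk : t < k) (n : ℕ) :
    ((k : ℚ) * n + t + 2) * (t + 1) * markedCount k t (k * n) ((k + 1) * n) n =
      (k + t + 2) * n * (paths k t n).card := by
  have hk : (0 : ℤ) ≤ k := by positivity
  have h1 := prefixCount_eq htk ((k + 1) * n) n (by push_cast; linarith)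
  have h2 := mul_chooseInt ((k + 1) * n + t) n
  have h3 := prefixCount_eq htk ((k + 1) * n) (n - 1) (by push_cast; linarith)
  have h4 := mul_chooseInt ((k + 1) * n + t) (n - 1)
  rw [prefixCount, ← paths_eq_prefixes] at h1
  rw [markedCount_last htk _ _ (by push_cast; ring) (by linarith), h1, h3]
  push_cast at h2 h4
  linear_combination (-(k : ℚ) - t - 2) * h2 + k * (t + 1) * h4

end KtDyck

theorem corollary2p5 (k t n : ℕ) (htk : t < k) :
    (KtDyck.paths k t n).Nonempty ∧
    (∀ i : ℕ, k - t ≤ i → i ≤ k →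
      KtDyck.averageDownSteps k t n i =
        ((n : ℚ) * (((t : ℚ) + 1) * (n : ℚ) + (k : ℚ) + 1)) /
          (((k : ℚ) * (n : ℚ) + (t : ℚ) + 2) * ((t : ℚ) + 1))) ∧
    (∀ i : ℕ, 1 ≤ i → i ≤ k - t - 1 →
      KtDyck.averageDownSteps k t n i =
        ((n : ℚ) * ((n : ℚ) - 1)) / ((k : ℚ) * (n : ℚ) + (t : ℚ) + 2)) := by
  have hA := KtDyck.card_paths_mul htk n
  have hD := KtDyck.markedCount_last_mul htk n
  have hT := KtDyck.sum_markedCount_total htk n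
  have hApos : (0 : ℚ) < (KtDyck.paths k t n).card := by
    have h1 : (0 : ℚ) < (((k + 1) * n + t).choose n : ℚ) := by
      exact_mod_cast Nat.choose_pos (by nlinarith)
    have h2 : (0 : ℚ) < ((k : ℚ) * n + t + 1) * (KtDyck.paths k t n).card := by
      rw [hA]
      positivity
    exact pos_of_mul_pos_right h2 (by positivity)
  have hk : (k : ℚ) ≠ 0 := by
    have : k ≠ 0 := by omega
    exact_mod_cast this
  have hB : ((k : ℚ) * n + t + 2) ≠ 0 := by positivity
  have ht : ((t : ℚ) + 1) ≠ 0 := by positivity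
  refine ⟨Finset.card_pos.1 (by exact_mod_cast hApos), fun i hi hik => ?_, fun i hi hik => ?_⟩
  · rw [KtDyck.averageDownSteps, KtDyck.sum_paths_downStepsAt_high htk n hi hik,
      div_eq_div_iff hApos.ne' (mul_ne_zero hB ht)]
    -- Only k·E is known, from the total count; the factor k lets `hT` eliminate E and `hD` then
    -- eliminate D.
    apply mul_left_cancel₀ hk
    linear_combination ((k : ℚ) * n + t + 2) * (t + 1) * hT + (k - t - 1) * hD
  · rw [KtDyck.averageDownSteps, KtDyck.sum_paths_downStepsAt_low htk n hi hik,
      div_eq_div_iff hApos.ne' hB]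
    apply mul_left_cancel₀ hk
    linear_combination ((k : ℚ) * n + t + 2) * hT - hD
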